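/- Let $D$ be a division ring with center $F$, and let $F\langle x_1,x_2,\ldots\rangle$ be the free associative unital $F$-algebra in countably many noncommuting variables. For a polynomial $q$ in it and an associative unital $F$-algebra $A$, write $q(A)\subseteq A$ for the set of all values of $q$ obtained by substituting elements of $A$ for the variables. Call $q$ multilinear in the variables $y_1,\ldots,y_m$, where $m\ge 1$ and $y_1,\ldots,y_m$ are distinct elements of $\{x_1,x_2,\ldots\}$, if $$q=\sum_{\sigma\in S_m}\lambda_\sigma\, y_{\sigma(1)}y_{\sigma(2)}\cdots y_{\sigma(m)}$$ for some $\lambda_\sigma\in F$. Let $p=p_1p_2$, where $p_1,p_2\in F\langle x_1,x_2,\ldots\rangle$ are multilinear in disjoint finite sets of variables, and suppose that, for $i=1,2$, $$p_i(\mathrm{M}_2(F))\neq\{0\}\quad\text{and}\quad p_i(\mathrm{M}_2(F))\neq Z(\mathrm{M}_2(F)),$$ where $Z(\mathrm{M}_2(F))$ denotes the center of $\mathrm{M}_2(F)$, that is, the set of scalar matrices. Then $p(\mathrm{M}_2(D))=\mathrm{M}_2(D)$. -/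

import Mathlib

open scoped BigOperators

/-- `IsMultilinearIn X p` says that the noncommutative polynomial `p` in the free algebra over `F`
on countably many variables is multilinear, with (nonempty, finite) set of variables `X`: writing
`X = {v 0, ..., v (m - 1)}` with `m` positive and the `v i` distinct, `p` is a combination
of the monomials `x_{v (σ 0)} * ... * x_{v (σ (m - 1))}`, where `σ` is a permutation. -/
def IsMultilinearIn {F : Type*} [Field F] (X : Finset ℕ) (p : FreeAlgebra F ℕ) : Prop :=
  ∃ (m : ℕ) (v : Fin m ↪ ℕ) (c : Equiv.Perm (Fin m) → F),
    0 < m ∧ Finset.univ.map v = X ∧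
      p = ∑ σ : Equiv.Perm (Fin m),
        c σ • (List.ofFn fun i : Fin m => FreeAlgebra.ι F (v (σ i))).prod

/-- The image of the noncommutative polynomial `p` evaluated on the algebra `A`: the set of all
values of `p` under substitution of elements of `A` for the variables. -/
def polyImage {F : Type*} [Field F] (A : Type*) [Ring A] [Algebra F A]
    (p : FreeAlgebra F ℕ) : Set A :=
  {y | ∃ a : ℕ → A, FreeAlgebra.lift F a p = y}

/-!
The image `Sᵢ` of `pᵢ` on `M₂(F)` is invariant under conjugation and, by the hypotheses, contains a
noncentral matrix, so some value of `pᵢ` has a nonzero `(0, 1)` entry. By multilinearity such a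
value `t • E₀₁` is attained at matrix units. Exchanging the two indices conjugates it into
`t • E₁₀` and keeps every argument diagonal or antidiagonal, as it was. On such homogeneous
arguments `pᵢ` is therefore a multilinear map into the plane of antidiagonal matrices whose values
do not lie on one line, and this forces it to be onto the plane already when a single variable
varies. Scalars from `D` commute with `M₂(F)`, so multiplying this one variable by them gives all
antidiagonal matrices over `D`. A similar argument gives an invertible diagonal value of `p₁`.
Finally, a nondiagonal matrix over `D` is similar to a companion matrix, which is a product of
conjugates of antidiagonal matrices, or of that diagonal matrix and an antidiagonal one.
-/

section MultilinearMap

theorem exists_apply_ne_zero_and_apply_ne_zero {R : Type*} [CommSemiring R] {n : ℕ}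
    {M : Fin n → Type*} [∀ i, AddCommMonoid (M i)] [∀ i, Module R (M i)]
    {N N' : Type*} [AddCommMonoid N] [Module R N] [AddCommMonoid N'] [Module R N']
    {f : MultilinearMap R M N} {g : MultilinearMap R M N'} (hf : f ≠ 0) (hg : g ≠ 0) :
    ∃ x, f x ≠ 0 ∧ g x ≠ 0 := by
  induction n with
  | zero =>
    obtain ⟨x, hx⟩ := DFunLike.ne_iff.1 hf
    obtain ⟨y, hy⟩ := DFunLike.ne_iff.1 hg
    exact ⟨x, hx, Subsingleton.elim y x ▸ hy⟩
  | succ n ih =>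
    obtain ⟨v, hfv, hgv⟩ : ∃ v, f.curryLeft v ≠ 0 ∧ g.curryLeft v ≠ 0 := by
      obtain ⟨a, ha⟩ : ∃ a, f.curryLeft a ≠ 0 := DFunLike.ne_iff.1 fun h =>
        hf ((multilinearCurryLeftEquiv R M N).injective h)
      obtain ⟨b, hb⟩ : ∃ b, g.curryLeft b ≠ 0 := DFunLike.ne_iff.1 fun h =>
        hg ((multilinearCurryLeftEquiv R M N').injective h)
      by_cases hga : g.curryLeft a = 0
      · by_cases hfb : f.curryLeft b = 0
        · exact ⟨a + b, by rwa [map_add, hfb, add_zero], by rwa [map_add, hga, zero_add]⟩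
        · exact ⟨b, hfb, hb⟩
      · exact ⟨a, ha, hga⟩
    obtain ⟨x, hfx, hgx⟩ := ih hfv hgv
    exact ⟨Fin.cons v x, hfx, hgx⟩

variable {K : Type*} [Field K] {n : ℕ} {M : Fin n → Type*} [∀ i, AddCommGroup (M i)]
  [∀ i, Module K (M i)] {W : Type*} [AddCommGroup W] [Module K W]

theorem exists_linearIndependent_update (f : MultilinearMap K M W)
    (h : ∃ x y, LinearIndependent K ![f x, f y]) :
    ∃ x i u v,
      LinearIndependent K ![f (Function.update x i u), f (Function.update x i v)] := by
  obtain ⟨x, y, hxy⟩ := h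
  induction n with
  | zero => exact absurd (congrArg f (Subsingleton.elim x y)) (hxy.injective.ne zero_ne_one)
  | succ n ih =>
    by_cases! hslice :
      ∃ a z w, LinearIndependent K ![f (Fin.cons (α := M) a z), f (Fin.cons (α := M) a w)]
    · obtain ⟨a, z, w, hzw⟩ := hslice
      obtain ⟨x, i, u, v, huv⟩ := ih (f.curryLeft a) z w hzw
      refine ⟨Fin.cons a x, i.succ, u, v, ?_⟩
      simpa only [MultilinearMap.curryLeft_apply, Fin.cons_update] using huv
    -- Otherwise, once the first variable is fixed, all values of `f` lie on one line.
    · have mem_line (a : M 0) (z w : ∀ i : Fin n, M i.succ) (hz : f (Fin.cons a z) ≠ 0) :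
          ∃ s : K, s • f (Fin.cons a z) = f (Fin.cons a w) := by
        simpa [LinearIndependent.pair_iff' hz] using hslice a z w
      have hx : f.curryLeft (x 0) ≠ 0 := fun h => hxy.ne_zero 0 <| by
        simpa using DFunLike.congr_fun h (Fin.tail x)
      have hy : f.curryLeft (y 0) ≠ 0 := fun h => hxy.ne_zero 1 <| by
        simpa using DFunLike.congr_fun h (Fin.tail y)
      obtain ⟨z, hxz, hyz⟩ := exists_apply_ne_zero_and_apply_ne_zero hx hy
      obtain ⟨s, hs⟩ := mem_line (x 0) z (Fin.tail x) hxz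
      obtain ⟨t, ht⟩ := mem_line (y 0) z (Fin.tail y) hyz
      rw [Fin.cons_self_tail] at hs ht
      have hs0 : s ≠ 0 := left_ne_zero_of_smul (hs.trans_ne (hxy.ne_zero 0))
      have ht0 : t ≠ 0 := left_ne_zero_of_smul (ht.trans_ne (hxy.ne_zero 1))
      refine ⟨Fin.cons (x 0) z, 0, x 0, y 0, ?_⟩
      rw [Fin.update_cons_zero, Fin.update_cons_zero]
      rwa [← hs, ← ht, LinearIndependent.pair_smul_smul_iff hs0.isUnit ht0.isUnit] at hxy

theorem exists_surjective_toLinearMap (hW : Module.finrank K W = 2) (f : MultilinearMap K M W)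
    (h : ∃ x y, LinearIndependent K ![f x, f y]) :
    ∃ x i, Function.Surjective (f.toLinearMap x i) := by
  obtain ⟨x, i, u, v, huv⟩ := exists_linearIndependent_update f h
  have : FiniteDimensional K W := Module.finite_of_finrank_eq_succ hW
  refine ⟨x, i, LinearMap.range_eq_top.1 (top_le_iff.1 ?_)⟩
  rw [← huv.span_eq_top_of_card_eq_finrank' (by simp [hW]), Submodule.span_le]
  rintro _ ⟨j, rfl⟩
  fin_cases j
  · exact ⟨u, rfl⟩
  · exact ⟨v, rfl⟩

end MultilinearMap

section ConjInvariant

/-- A subset of a monoid that is closed under conjugation by units. Images of polynomials have this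
property, which allows their elements to be put into normal form. -/
def IsConjInvariant {M : Type*} [Monoid M] (S : Set M) : Prop :=
  ∀ ⦃a b : M⦄, IsConj a b → a ∈ S → b ∈ S

open Pointwise in
theorem IsConjInvariant.mul {M : Type*} [Monoid M] {S T : Set M} (hS : IsConjInvariant S)
    (hT : IsConjInvariant T) : IsConjInvariant (S * T) := by
  rintro _ b ⟨u, hu⟩ ⟨y, hy, z, hz, rfl⟩
  refine ⟨u * y * ↑u⁻¹, hS ⟨u, by simp [SemiconjBy]⟩ hy, u * z * ↑u⁻¹,
    hT ⟨u, by simp [SemiconjBy]⟩ hz, ?_⟩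
  calc u * y * ↑u⁻¹ * (u * z * ↑u⁻¹) = u * (y * z) * ↑u⁻¹ := by simp [mul_assoc]
    _ = b := by rw [hu.eq, mul_assoc, u.mul_inv, mul_one]

theorem isConj_swap {R : Type*} [Semiring R] (a b c d : R) :
    IsConj !![a, b; c, d] !![d, c; b, a] :=
  ⟨⟨!![0, 1; 1, 0], !![0, 1; 1, 0], by simp [Matrix.one_fin_two], by simp [Matrix.one_fin_two]⟩,
    by simp [SemiconjBy]⟩

theorem isConj_transvection {R : Type*} [Ring R] (s a b c d : R) :
    IsConj !![a, b; c, d] !![a + s * c, b + s * d - (a + s * c) * s; c, d - c * s] :=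
  ⟨⟨!![1, s; 0, 1], !![1, -s; 0, 1], by simp [Matrix.one_fin_two], by simp [Matrix.one_fin_two]⟩,
    by simp [SemiconjBy]⟩

theorem isConj_companion {D : Type*} [DivisionRing D] (a b d : D) {c : D} (hc : c ≠ 0) :
    IsConj !![0, b * c - a * c⁻¹ * d * c; 1, a + c⁻¹ * d * c] !![a, b; c, d] :=
  ⟨⟨!![1, a; 0, c], !![1, -(a * c⁻¹); 0, c⁻¹], by simp [Matrix.one_fin_two, hc],
    by simp [Matrix.one_fin_two, hc]⟩, by simp [SemiconjBy, hc, mul_add, mul_assoc, add_comm]⟩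

namespace IsConjInvariant

theorem exists_apply_zero_one_ne_zero {R : Type*} [CommRing R]
    {S : Set (Matrix (Fin 2) (Fin 2) R)} (hS : IsConjInvariant S) (h : ¬ S ⊆ Set.center _) :
    ∃ y ∈ S, y 0 1 ≠ 0 := by
  contrapose! h
  intro y hy
  have hy' : !![y 0 0, y 0 1; y 1 0, y 1 1] ∈ S := y.eta_fin_two ▸ hy
  have h₀₁ : y 0 1 = 0 := h _ hy
  have h₁₀ : y 1 0 = 0 := h _ (hS (isConj_swap _ _ _ _) hy')
  have h₁₁ : y 1 1 = y 0 0 := by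
    have := h _ (hS (isConj_transvection 1 _ _ _ _) hy')
    simpa [h₀₁, h₁₀, sub_eq_zero] using this
  rw [Matrix.center_eq_range]
  refine ⟨y 0 0, ?_⟩
  ext i j
  fin_cases i <;> fin_cases j <;> simp [h₀₁, h₁₀, h₁₁]

theorem exists_apply_zero_zero_ne_zero {R : Type*} [Ring R]
    {S : Set (Matrix (Fin 2) (Fin 2) R)} (hS : IsConjInvariant S) (h : ∃ y ∈ S, y 0 1 ≠ 0) :
    ∃ y ∈ S, y 0 0 ≠ 0 := by
  contrapose! h
  intro y hy
  have hy' : !![y 1 1, y 1 0; y 0 1, y 0 0] ∈ S :=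
    hS (isConj_swap _ _ _ _) (y.eta_fin_two ▸ hy)
  have h₁₁ : y 1 1 = 0 := h _ hy'
  simpa [h₁₁] using h _ (hS (isConj_transvection 1 _ _ _ _) hy')

theorem mem_of_antidiagonal_mem {R : Type*} [Ring R] {S : Set (Matrix (Fin 2) (Fin 2) R)}
    (hS : IsConjInvariant S) (hanti : ∀ d e, !![0, d; e, 0] ∈ S) (s t : R) :
    !![s, t; 1, -s] ∈ S := by
  simpa using hS (isConj_transvection s _ _ _ _) (hanti (s * s + t) 1)

variable {D : Type*} [DivisionRing D] {S T : Set (Matrix (Fin 2) (Fin 2) D)}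

open Pointwise

theorem companion_mem_mul (hS : IsConjInvariant S) (hT : IsConjInvariant T)
    (hSa : ∀ d e, !![0, d; e, 0] ∈ S) (hTa : ∀ d e, !![0, d; e, 0] ∈ T)
    (hSd : ∃ a b, a ≠ 0 ∧ b ≠ 0 ∧ !![a, 0; 0, b] ∈ S) (a b : D) :
    !![0, a; 1, b] ∈ S * T := by
  by_cases hb : b = 0
  · obtain ⟨p, q, hp, hq, hpq⟩ := hSd
    exact ⟨_, hpq, _, hTa (p⁻¹ * a) q⁻¹, by simp [hb, hp, hq]⟩
  by_cases ha : a = 0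
  · exact ⟨_, hSa 0 1, _, hT.mem_of_antidiagonal_mem hTa 1 b, by
      ext i j; fin_cases i <;> fin_cases j <;> simp [ha]⟩
  have h : !![b, a; 1, 0] ∈ S * T :=
    ⟨_, hSa b (-(b⁻¹ * a))⁻¹, _, hT.mem_of_antidiagonal_mem hTa (-(b⁻¹ * a)) 0, by
      simp [hb, mul_assoc, inv_mul_cancel₀ ha]⟩
  simpa using (hS.mul hT) (isConj_transvection (-b) _ _ _ _) h

theorem mul_eq_univ (hS : IsConjInvariant S) (hT : IsConjInvariant T)
    (hSa : ∀ d e, !![0, d; e, 0] ∈ S) (hTa : ∀ d e, !![0, d; e, 0] ∈ T)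
    (hSd : ∃ a b, a ≠ 0 ∧ b ≠ 0 ∧ !![a, 0; 0, b] ∈ S) : S * T = Set.univ := by
  have lower (a b d : D) {c : D} (hc : c ≠ 0) : !![a, b; c, d] ∈ S * T :=
    (hS.mul hT) (isConj_companion a b d hc) (companion_mem_mul hS hT hSa hTa hSd _ _)
  refine Set.eq_univ_of_forall fun A => ?_
  rw [A.eta_fin_two]
  by_cases h₁₀ : A 1 0 = 0
  · by_cases h₀₁ : A 0 1 = 0
    · exact ⟨_, hSa (A 0 0) (A 1 1), _, hTa 1 1, by simp [h₁₀, h₀₁]⟩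
    · exact (hS.mul hT) (isConj_swap _ _ _ _) (lower _ _ _ h₀₁)
  · exact lower _ _ _ h₁₀

end IsConjInvariant

end ConjInvariant

section MultilinearEval

variable {F : Type*} [Field F] {m : ℕ} (c : Equiv.Perm (Fin m) → F)

/-- The evaluation on an algebra `A` of the multilinear polynomial with coefficients `c`, as a
multilinear map in its `m` variables; unlike `FreeAlgebra.lift`, it only takes the values of these
variables as arguments. -/
def multilinearEval (A : Type*) [Ring A] [Algebra F A] : MultilinearMap F (fun _ : Fin m => A) A :=
  ∑ σ : Equiv.Perm (Fin m), c σ • (MultilinearMap.mkPiAlgebraFin F m A).domDomCongr σ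

variable {A B : Type*} [Ring A] [Algebra F A] [Ring B] [Algebra F B]

theorem multilinearEval_apply (x : Fin m → A) :
    multilinearEval c A x = ∑ σ : Equiv.Perm (Fin m), c σ • (List.ofFn fun i => x (σ i)).prod := by
  simp [multilinearEval]

theorem multilinearEval_map (φ : A →ₐ[F] B) (x : Fin m → A) :
    multilinearEval c B (fun i => φ (x i)) = φ (multilinearEval c A x) := by
  simp only [multilinearEval_apply, map_sum, map_smul, map_list_prod, List.map_ofFn,
    Function.comp_def]

theorem prod_ofFn_update_mul {M : Type*} [Monoid M] {n : ℕ} (x : Fin n → M) (i : Fin n)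
    {z : M} (hz : ∀ j, Commute z (x j)) :
    (List.ofFn (Function.update x i (x i * z))).prod = (List.ofFn x).prod * z := by
  induction n with
  | zero => exact i.elim0
  | succ n ih =>
    rw [List.ofFn_succ, List.ofFn_succ, List.prod_cons, List.prod_cons]
    cases i using Fin.cases with
    | zero =>
      have hz_tail : Commute z (List.ofFn fun j : Fin n => x j.succ).prod :=
        Commute.list_prod_right _ _ fun y hy => by
          obtain ⟨j, rfl⟩ := List.mem_ofFn.1 hy
          exact hz _
      simp [mul_assoc, hz_tail.eq]
    | succ i =>
      have h_tail : (fun j : Fin n => Function.update x i.succ (x i.succ * z) j.succ) =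
          Function.update (fun j => x j.succ) i (x i.succ * z) := Fin.tail_update_succ ..
      rw [h_tail, ih (fun j => x j.succ) i fun j => hz _,
        Function.update_of_ne (Fin.succ_ne_zero i).symm, mul_assoc]

theorem multilinearEval_update_mul (x : Fin m → A) (i : Fin m) {z : A}
    (hz : ∀ j, Commute z (x j)) :
    multilinearEval c A (Function.update x i (x i * z)) = multilinearEval c A x * z := by
  simp only [multilinearEval_apply, Finset.sum_mul, smul_mul_assoc]
  refine Finset.sum_congr rfl fun σ _ => ?_
  have h_perm : (fun j => Function.update x i (x i * z) (σ j)) =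
      Function.update (x ∘ σ) (σ.symm i) ((x ∘ σ) (σ.symm i) * z) := by
    rw [Function.comp_apply, σ.apply_symm_apply]
    exact Function.update_comp_equiv x σ i _
  rw [h_perm, prod_ofFn_update_mul (x ∘ σ) _ fun j => hz _, Function.comp_def]

theorem multilinearEval_update_map_mul (φ : A →ₐ[F] B) (x : Fin m → A) (i : Fin m) (u : A)
    {z : B} (hz : ∀ a, Commute z (φ a)) :
    multilinearEval c B (Function.update (fun l => φ (x l)) i (φ u * z)) =
      φ (multilinearEval c A (Function.update x i u)) * z := by
  have h := multilinearEval_update_mul c (fun l => φ (Function.update x i u l)) i fun j => hz _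
  simpa [← multilinearEval_map, Function.apply_update fun _ => φ] using h

end MultilinearEval

section PolyImage

variable {F : Type*} [Field F] {A B : Type*} [Ring A] [Algebra F A] [Ring B] [Algebra F B]
  {p p₁ p₂ : FreeAlgebra F ℕ} {X X₁ X₂ : Finset ℕ}

theorem map_mem_polyImage (φ : A →ₐ[F] B) {y : A} (hy : y ∈ polyImage A p) :
    φ y ∈ polyImage B p := by
  obtain ⟨a, rfl⟩ := hy
  refine ⟨φ ∘ a, ?_⟩
  rw [← AlgHom.comp_apply]
  congr 1
  ext
  simp

theorem isConjInvariant_polyImage : IsConjInvariant (polyImage A p) := by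
  rintro y z ⟨u, hu⟩ hy
  have h := map_mem_polyImage
    (MulSemiringAction.toAlgHom F A (ConjAct.toConjAct u)) hy
  simpa [ConjAct.units_smul_def, hu.eq, mul_assoc] using h

theorem lift_eq_multilinearEval {m : ℕ} (c : Equiv.Perm (Fin m) → F) (v : Fin m → ℕ)
    (a : ℕ → A) :
    FreeAlgebra.lift F a (∑ σ : Equiv.Perm (Fin m),
        c σ • (List.ofFn fun i : Fin m => FreeAlgebra.ι F (v (σ i))).prod) =
      multilinearEval c A (fun i => a (v i)) := by
  simp only [multilinearEval_apply, map_sum, map_smul, map_list_prod, List.map_ofFn,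
    Function.comp_def, FreeAlgebra.lift_ι_apply]

theorem polyImage_eq_range {m : ℕ} (c : Equiv.Perm (Fin m) → F) (v : Fin m ↪ ℕ) :
    polyImage A (∑ σ : Equiv.Perm (Fin m),
        c σ • (List.ofFn fun i : Fin m => FreeAlgebra.ι F (v (σ i))).prod) =
      Set.range (multilinearEval c A) := by
  ext y
  simp only [polyImage, Set.mem_ofPred_eq, lift_eq_multilinearEval, Set.mem_range]
  constructor
  · rintro ⟨a, h⟩
    exact ⟨_, h⟩
  · rintro ⟨x, h⟩
    exact ⟨Function.extend v x 0, by simpa [v.injective.extend_apply] using h⟩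

namespace IsMultilinearIn

theorem lift_congr (hp : IsMultilinearIn X p) {a b : ℕ → A} (hab : ∀ k ∈ X, a k = b k) :
    FreeAlgebra.lift F a p = FreeAlgebra.lift F b p := by
  obtain ⟨m, v, c, -, rfl, rfl⟩ := hp
  simp only [lift_eq_multilinearEval]
  congr! 2 with i
  exact hab _ (by simp)

open Pointwise in
theorem polyImage_mul (h₁ : IsMultilinearIn X₁ p₁) (h₂ : IsMultilinearIn X₂ p₂)
    (hX : Disjoint X₁ X₂) : polyImage A (p₁ * p₂) = polyImage A p₁ * polyImage A p₂ := by
  ext y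
  constructor
  · rintro ⟨a, rfl⟩
    exact ⟨_, ⟨a, rfl⟩, _, ⟨a, rfl⟩, (map_mul _ _ _).symm⟩
  · rintro ⟨_, ⟨a, rfl⟩, _, ⟨b, rfl⟩, rfl⟩
    refine ⟨fun k => if k ∈ X₁ then a k else b k, ?_⟩
    rw [map_mul, h₁.lift_congr (b := a) fun k hk => if_pos hk,
      h₂.lift_congr (b := b) fun k hk => if_neg (Finset.disjoint_right.1 hX hk)]

theorem smul_mem_polyImage (hp : IsMultilinearIn X p) (t : F) {y : A}
    (hy : y ∈ polyImage A p) : t • y ∈ polyImage A p := by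
  obtain ⟨m, v, c, hm, -, rfl⟩ := hp
  rw [polyImage_eq_range] at hy ⊢
  obtain ⟨x, rfl⟩ := hy
  refine ⟨Function.update x ⟨0, hm⟩ (t • x ⟨0, hm⟩), ?_⟩
  rw [MultilinearMap.map_update_smul, Function.update_eq_self]

theorem not_polyImage_subset_center [Algebra.IsCentral F A] (hp : IsMultilinearIn X p)
    (h_zero : polyImage A p ≠ {0}) (h_center : polyImage A p ≠ Set.center A) :
    ¬ polyImage A p ⊆ Set.center A := by
  intro h_sub
  have mem_center (y : A) : y ∈ Set.center A ↔ ∃ s, y = algebraMap F A s :=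
    Algebra.IsCentral.mem_center_iff F
  obtain ⟨y, hy, hy0⟩ : ∃ y ∈ polyImage A p, y ≠ 0 := by
    by_contra! h
    exact h_zero (Set.eq_singleton_iff_nonempty_unique_mem.2 ⟨⟨_, 0, rfl⟩, h⟩)
  obtain ⟨s, rfl⟩ := (mem_center y).1 (h_sub hy)
  have hs : s ≠ 0 := by rintro rfl; exact hy0 (map_zero _)
  refine h_center (h_sub.antisymm fun z hz => ?_)
  obtain ⟨t, rfl⟩ := (mem_center z).1 hz
  simpa [Algebra.smul_def, ← map_mul, hs] using hp.smul_mem_polyImage (t / s) hy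

end IsMultilinearIn

end PolyImage

section ElementaryGrading

variable {G ι : Type*} [AddCommGroup G]

/-- The elementary grading of a matrix algebra induced by degrees `δ` of the indices: the matrix
unit at `(i, j)` is homogeneous of degree `δ j - δ i`. -/
def elementaryGrading (R : Type*) [Semiring R] (δ : ι → G) (g : G) :
    Submodule R (Matrix ι ι R) where
  carrier := {y | ∀ i j, y i j ≠ 0 → δ j - δ i = g}
  zero_mem' _ _ h := absurd rfl h
  add_mem' {y z} hy hz i j h := by
    by_cases hyij : y i j = 0
    · exact hz i j fun hzij => h (by simp [hyij, hzij])
    · exact hy i j hyij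
  smul_mem' _ _ hy i j h := hy i j (right_ne_zero_of_mul h)

variable [DecidableEq ι]

theorem single_mem_elementaryGrading {R : Type*} [Semiring R] (δ : ι → G) (i j : ι) (a : R) :
    Matrix.single i j a ∈ elementaryGrading R δ (δ j - δ i) := by
  intro p q h
  obtain ⟨rfl, rfl⟩ : i = p ∧ j = q := by_contra fun hpq =>
    h (Matrix.single_apply_of_ne _ _ _ _ _ hpq)
  rfl

variable [Fintype ι]

instance {R : Type*} [Semiring R] (δ : ι → G) :
    SetLike.GradedMonoid (elementaryGrading R δ) where
  one_mem i j h := by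
    obtain rfl : i = j := by_contra fun hij => h (Matrix.one_apply_ne hij)
    exact sub_self _
  mul_mem _ _ y z hy hz i j h := by
    obtain ⟨l, -, hl⟩ := Finset.exists_ne_zero_of_sum_ne_zero h
    rw [← hy i l (left_ne_zero_of_mul hl), ← hz l j (right_ne_zero_of_mul hl),
      add_comm, sub_add_sub_cancel]

variable {F : Type*} [Field F] {m : ℕ} (c : Equiv.Perm (Fin m) → F)

/-- The restriction of `multilinearEval c A` to homogeneous arguments of prescribed degrees `k`. All
its values lie in a single homogeneous component, which may be much smaller than `A`. -/
def gradedEval {A : Type*} [Ring A] [Algebra F A] (𝒜 : G → Submodule F A) (k : Fin m → G) :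
    MultilinearMap F (fun l => 𝒜 (k l)) A :=
  (multilinearEval c A).compLinearMap fun l => (𝒜 (k l)).subtype

theorem gradedEval_mem {A : Type*} [Ring A] [Algebra F A] (𝒜 : G → Submodule F A)
    [SetLike.GradedMonoid 𝒜] (k : Fin m → G) (x : ∀ l, 𝒜 (k l)) :
    gradedEval c 𝒜 k x ∈ 𝒜 (∑ l, k l) := by
  rw [gradedEval, MultilinearMap.compLinearMap_apply, multilinearEval_apply]
  refine Submodule.sum_mem _ fun σ _ => Submodule.smul_mem _ _ ?_
  rw [← Equiv.sum_comp σ k, ← List.sum_ofFn]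
  exact SetLike.list_prod_ofFn_mem_graded _ _ fun l => (x (σ l)).2

theorem exists_single_apply_ne_zero {i j : ι}
    (h : ∃ x, multilinearEval c (Matrix ι ι F) x i j ≠ 0) :
    ∃ r : Fin m → ι × ι,
      multilinearEval c (Matrix ι ι F) (fun l => Matrix.single (r l).1 (r l).2 1) i j ≠ 0 := by
  contrapose! h
  have h_zero : (Matrix.entryLinearMap F F i j).compMultilinearMap
      (multilinearEval c (Matrix ι ι F)) = 0 :=
    Module.Basis.ext_multilinear (fun _ => Matrix.stdBasis F ι ι) fun r => by
      simpa [funext fun l => Matrix.stdBasis_eq_single F (r l).1 (r l).2] using h r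
  exact fun x => DFunLike.congr_fun h_zero x

variable (r : Fin m → ι × ι)

theorem sum_degree_of_single_apply_ne_zero (δ : ι → G) {i j : ι}
    (h : multilinearEval c (Matrix ι ι F) (fun l => Matrix.single (r l).1 (r l).2 1) i j ≠ 0) :
    ∑ l, (δ (r l).2 - δ (r l).1) = δ j - δ i :=
  (gradedEval_mem c (elementaryGrading F δ) _
    (fun l => ⟨_, single_mem_elementaryGrading δ (r l).1 (r l).2 1⟩) i j h).symm

theorem multilinearEval_single_eq_single {i j : ι} (hij : i ≠ j)
    (h : multilinearEval c (Matrix ι ι F) (fun l => Matrix.single (r l).1 (r l).2 1) i j ≠ 0) :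
    ∃ t ≠ 0, multilinearEval c (Matrix ι ι F) (fun l => Matrix.single (r l).1 (r l).2 1) =
      Matrix.single i j t := by
  refine ⟨_, h, ?_⟩
  ext p q
  by_cases hpq : i = p ∧ j = q
  · obtain ⟨rfl, rfl⟩ := hpq
    rw [Matrix.single_apply_same]
  rw [Matrix.single_apply_of_ne _ _ _ _ _ hpq]
  by_contra hne
  -- The degrees `δ q - δ p`, with `δ` the standard basis of `ι → ℤ`, separate the pairs `p ≠ q`.
  let δ : ι → ι → ℤ := fun l => Pi.single l 1
  have h_deg : δ q - δ p = δ j - δ i :=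
    (sum_degree_of_single_apply_ne_zero c r δ hne).symm.trans
      (sum_degree_of_single_apply_ne_zero c r δ h)
  have h_i := congrFun h_deg i
  have h_j := congrFun h_deg j
  simp only [δ, Pi.sub_apply, Pi.single_apply] at h_i h_j
  grind

end ElementaryGrading

section Parity

variable {F : Type*} [Field F] {m : ℕ} (c : Equiv.Perm (Fin m) → F)

/-- The grading of two by two matrices by `ZMod 2`, with diagonal matrices of degree `0` and
antidiagonal matrices of degree `1`. -/
abbrev parityGrading (R : Type*) [Semiring R] : ZMod 2 → Submodule R (Matrix (Fin 2) (Fin 2) R) :=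
  elementaryGrading R ![0, 1]

section

variable {R : Type*} [Semiring R] {y : Matrix (Fin 2) (Fin 2) R}

theorem eq_diagonal_of_mem_parityGrading_zero (hy : y ∈ parityGrading R 0) :
    y = !![y 0 0, 0; 0, y 1 1] := by
  have h₀₁ : y 0 1 = 0 := by_contra fun h => absurd (hy 0 1 h) (by decide)
  have h₁₀ : y 1 0 = 0 := by_contra fun h => absurd (hy 1 0 h) (by decide)
  nth_rw 1 [y.eta_fin_two, h₀₁, h₁₀]

theorem eq_antidiagonal_of_mem_parityGrading_one (hy : y ∈ parityGrading R 1) :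
    y = !![0, y 0 1; y 1 0, 0] := by
  have h₀₀ : y 0 0 = 0 := by_contra fun h => absurd (hy 0 0 h) (by decide)
  have h₁₁ : y 1 1 = 0 := by_contra fun h => absurd (hy 1 1 h) (by decide)
  nth_rw 1 [y.eta_fin_two, h₀₀, h₁₁]

theorem submatrix_rev_mem_parityGrading {k : ZMod 2} (hy : y ∈ parityGrading R k) :
    y.submatrix Fin.rev Fin.rev ∈ parityGrading R k := by
  intro i j h
  rw [← hy _ _ h]
  clear h
  decide +revert

end

theorem exists_gradedEval_eq_submatrix_rev (k : Fin m → ZMod 2) (x : ∀ l, parityGrading F (k l)) :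
    ∃ y, gradedEval c (parityGrading F) k y =
      (gradedEval c (parityGrading F) k x).submatrix Fin.rev Fin.rev :=
  ⟨fun l => ⟨_, submatrix_rev_mem_parityGrading (x l).2⟩,
    multilinearEval_map c (Matrix.reindexAlgEquiv F F Fin.revPerm : _ ≃ₐ[F] _).toAlgHom
      fun l => (x l : Matrix (Fin 2) (Fin 2) F)⟩

theorem exists_update_eq_antidiagonal
    (h : ∃ x, multilinearEval c (Matrix (Fin 2) (Fin 2) F) x 0 1 ≠ 0) :
    ∃ (x : Fin m → Matrix (Fin 2) (Fin 2) F) (i : Fin m), ∀ a b : F, ∃ u,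
      multilinearEval c (Matrix (Fin 2) (Fin 2) F) (Function.update x i u) = !![0, a; b, 0] := by
  obtain ⟨r, hr⟩ := exists_single_apply_ne_zero c h
  let k : Fin m → ZMod 2 := fun l => ![0, 1] (r l).2 - ![0, 1] (r l).1
  have hk : ∑ l, k l = 1 := sum_degree_of_single_apply_ne_zero c r ![0, 1] hr
  obtain ⟨t, ht, hrt⟩ := multilinearEval_single_eq_single c r zero_ne_one hr
  let f := gradedEval c (parityGrading F) k
  let x₀ : ∀ l, parityGrading F (k l) := fun l => ⟨_, single_mem_elementaryGrading _ _ _ 1⟩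
  have hx₀ : f x₀ = Matrix.single 0 1 t := hrt
  obtain ⟨y₀, hy₀⟩ := exists_gradedEval_eq_submatrix_rev c k x₀
  let offDiag : Matrix (Fin 2) (Fin 2) F →ₗ[F] F × F :=
    (Matrix.entryLinearMap F F 0 1).prod (Matrix.entryLinearMap F F 1 0)
  have h_indep : LinearIndependent F ![offDiag (f x₀), offDiag (f y₀)] := by
    rw [hy₀, hx₀]
    simp [offDiag, LinearIndependent.pair_iff, ht]
  obtain ⟨x, i, h_surj⟩ := exists_surjective_toLinearMap (by simp)
    (offDiag.compMultilinearMap f) ⟨x₀, y₀, h_indep⟩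
  refine ⟨fun l => x l, i, fun a b => ?_⟩
  obtain ⟨u, hu⟩ := h_surj (a, b)
  refine ⟨u, ?_⟩
  have h_mem := gradedEval_mem c (parityGrading F) k (Function.update x i u)
  rw [hk] at h_mem
  calc multilinearEval c (Matrix (Fin 2) (Fin 2) F) (Function.update (fun l => ↑(x l)) i ↑u)
      = f (Function.update x i u) := by
        simp [f, gradedEval, Function.apply_update fun l (y : parityGrading F (k l)) => y.1]
    _ = !![0, a; b, 0] := by
        rw [eq_antidiagonal_of_mem_parityGrading_one h_mem]
        exact congrArg (fun q : F × F => !![0, q.1; q.2, 0]) hu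

theorem exists_diagonal_mem_range
    (h : ∃ x, multilinearEval c (Matrix (Fin 2) (Fin 2) F) x 0 0 ≠ 0) :
    ∃ a b : F, a ≠ 0 ∧ b ≠ 0 ∧
      !![a, 0; 0, b] ∈ Set.range (multilinearEval c (Matrix (Fin 2) (Fin 2) F)) := by
  obtain ⟨r, hr⟩ := exists_single_apply_ne_zero c h
  let k : Fin m → ZMod 2 := fun l => ![0, 1] (r l).2 - ![0, 1] (r l).1
  have hk : ∑ l, k l = 0 := sum_degree_of_single_apply_ne_zero c r ![0, 1] hr
  let f := gradedEval c (parityGrading F) k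
  let x₀ : ∀ l, parityGrading F (k l) := fun l => ⟨_, single_mem_elementaryGrading _ _ _ 1⟩
  obtain ⟨y₀, hy₀⟩ := exists_gradedEval_eq_submatrix_rev c k x₀
  have h₀₀ : (Matrix.entryLinearMap F F 0 0).compMultilinearMap f ≠ 0 :=
    DFunLike.ne_iff.2 ⟨x₀, hr⟩
  have h₁₁ : (Matrix.entryLinearMap F F 1 1).compMultilinearMap f ≠ 0 :=
    DFunLike.ne_iff.2 ⟨y₀, fun h => hr (by
      change f y₀ 1 1 = 0 at h
      rwa [hy₀] at h)⟩
  obtain ⟨x, hx₀₀, hx₁₁⟩ := exists_apply_ne_zero_and_apply_ne_zero h₀₀ h₁₁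
  have h_mem := gradedEval_mem c (parityGrading F) k x
  rw [hk] at h_mem
  exact ⟨_, _, hx₀₀, hx₁₁, _, eq_diagonal_of_mem_parityGrading_zero h_mem⟩

end Parity

section ExtensionOfScalars

variable {F D : Type*} [Field F] [DivisionRing D] [Algebra F D] {p : FreeAlgebra F ℕ}
  {X : Finset ℕ}

theorem commute_scalar_mapMatrix {n : Type*} [Fintype n] [DecidableEq n] (d : D)
    (y : Matrix n n F) : Commute (Matrix.scalar n d) ((Algebra.ofId F D).mapMatrix y) := by
  rw [Matrix.scalar_commute_iff]
  ext i j
  simp [Algebra.ofId_apply, Algebra.commutes]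

theorem antidiagonal_mem_polyImage (hp : IsMultilinearIn X p)
    (h : ∃ y ∈ polyImage (Matrix (Fin 2) (Fin 2) F) p, y 0 1 ≠ 0) (d e : D) :
    !![0, d; e, 0] ∈ polyImage (F := F) (Matrix (Fin 2) (Fin 2) D) p := by
  obtain ⟨m, v, c, -, -, rfl⟩ := hp
  simp only [polyImage_eq_range, Set.exists_range_iff] at h ⊢
  obtain ⟨x, i, h_slice⟩ := exists_update_eq_antidiagonal c h
  obtain ⟨u, hu⟩ := h_slice 1 0
  obtain ⟨w, hw⟩ := h_slice 0 1
  let φ := (Algebra.ofId F D).mapMatrix (m := Fin 2)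
  refine ⟨Function.update (fun l => φ (x l)) i
    (φ u * Matrix.scalar (Fin 2) d + φ w * Matrix.scalar (Fin 2) e), ?_⟩
  rw [MultilinearMap.map_update_add,
    multilinearEval_update_map_mul c φ x i u (commute_scalar_mapMatrix d),
    multilinearEval_update_map_mul c φ x i w (commute_scalar_mapMatrix e), hu, hw]
  ext i j
  fin_cases i <;> fin_cases j <;> simp [φ]

theorem exists_diagonal_mem_polyImage (hp : IsMultilinearIn X p)
    (h : ∃ y ∈ polyImage (Matrix (Fin 2) (Fin 2) F) p, y 0 0 ≠ 0) :
    ∃ a b : D, a ≠ 0 ∧ b ≠ 0 ∧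
      !![a, 0; 0, b] ∈ polyImage (F := F) (Matrix (Fin 2) (Fin 2) D) p := by
  obtain ⟨a, b, ha, hb, hab⟩ : ∃ a b : F, a ≠ 0 ∧ b ≠ 0 ∧
      !![a, 0; 0, b] ∈ polyImage (Matrix (Fin 2) (Fin 2) F) p := by
    obtain ⟨m, v, c, -, -, rfl⟩ := hp
    simp only [polyImage_eq_range, Set.exists_range_iff] at h ⊢
    exact exists_diagonal_mem_range c h
  refine ⟨algebraMap F D a, algebraMap F D b, by simpa, by simpa, ?_⟩
  convert map_mem_polyImage ((Algebra.ofId F D).mapMatrix (m := Fin 2)) hab using 1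
  ext i j
  fin_cases i <;> fin_cases j <;> simp [Algebra.ofId_apply]

end ExtensionOfScalars

theorem theorem4p6_general {F D : Type*} [Field F] [DivisionRing D] [Algebra F D]
    {p₁ p₂ : FreeAlgebra F ℕ} {X₁ X₂ : Finset ℕ} (hX : Disjoint X₁ X₂)
    (h₁ : IsMultilinearIn X₁ p₁) (h₂ : IsMultilinearIn X₂ p₂)
    (h₁_zero : polyImage (Matrix (Fin 2) (Fin 2) F) p₁ ≠ {0})
    (h₁_center : polyImage (Matrix (Fin 2) (Fin 2) F) p₁ ≠
      Set.center (Matrix (Fin 2) (Fin 2) F))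
    (h₂_zero : polyImage (Matrix (Fin 2) (Fin 2) F) p₂ ≠ {0})
    (h₂_center : polyImage (Matrix (Fin 2) (Fin 2) F) p₂ ≠
      Set.center (Matrix (Fin 2) (Fin 2) F)) :
    polyImage (Matrix (Fin 2) (Fin 2) D) (p₁ * p₂) = Set.univ := by
  have h₁_offDiag := isConjInvariant_polyImage.exists_apply_zero_one_ne_zero
    (h₁.not_polyImage_subset_center h₁_zero h₁_center)
  have h₂_offDiag := isConjInvariant_polyImage.exists_apply_zero_one_ne_zero
    (h₂.not_polyImage_subset_center h₂_zero h₂_center)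
  have h₁_diag := isConjInvariant_polyImage.exists_apply_zero_zero_ne_zero h₁_offDiag
  rw [h₁.polyImage_mul h₂ hX]
  exact isConjInvariant_polyImage.mul_eq_univ isConjInvariant_polyImage
    (antidiagonal_mem_polyImage h₁ h₁_offDiag) (antidiagonal_mem_polyImage h₂ h₂_offDiag)
    (exists_diagonal_mem_polyImage h₁ h₁_diag)

theorem theorem4p6 {F D : Type*} [Field F] [DivisionRing D] [Algebra F D] [Algebra.IsCentral F D]
    (p p₁ p₂ : FreeAlgebra F ℕ) (hp : p = p₁ * p₂)
    (X₁ X₂ : Finset ℕ) (hX : Disjoint X₁ X₂)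
    (h₁ : IsMultilinearIn X₁ p₁) (h₂ : IsMultilinearIn X₂ p₂)
    (h₁_zero : polyImage (Matrix (Fin 2) (Fin 2) F) p₁ ≠ {0})
    (h₁_center : polyImage (Matrix (Fin 2) (Fin 2) F) p₁ ≠
      Set.center (Matrix (Fin 2) (Fin 2) F))
    (h₂_zero : polyImage (Matrix (Fin 2) (Fin 2) F) p₂ ≠ {0})
    (h₂_center : polyImage (Matrix (Fin 2) (Fin 2) F) p₂ ≠
      Set.center (Matrix (Fin 2) (Fin 2) F)) :
    polyImage (Matrix (Fin 2) (Fin 2) D) p = Set.univ := by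
  subst hp
  exact theorem4p6_general hX h₁ h₂ h₁_zero h₁_center h₂_zero h₂_center
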